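/- A \emph{word} over a family $x=(x_i)_{i\in I}$ of elements of a group (with $I=\mathbb N$ or $I$ finite) is a finite sequence of letters $x_i^{\pm1}$. A \emph{left-order} on a group is a linear order $\preceq$ invariant under left multiplication; it is a \emph{bi-order} if it is also invariant under right multiplication. An order $\preceq$ on $G=\langle x\rangle$ is \emph{computable} with respect to the generating family $x$ if the set of pairs of words $(u,v)$ over $x$ with $u\preceq v$ in $G$ is recursive. A countable group $H$ \emph{has a computable left-order} (resp. bi-order) if it has a left-order (resp. bi-order) that is computable with respect to some generating sequence $(x_i)_{i\in\mathbb N}$ of $H$ (repetitions allowed). For a finitely generated group, computability of an order and decidability of membership in a subgroup (i.e. recursiveness of the set of words representing elements of the subgroup) are understood with respect to a finite generating family; neither depends on the choice of that family. Let $H$ be a countable group. The following are equivalent: (i) $H$ has a computable left-order (resp. bi-order); (ii) $H$ embeds in a finitely generated group $G$ with a computable left-order (resp. bi-order) such that membership in the image of $H$ is decidable in $G$; (iii) $H$ embeds as a subnormal subgroup in a finitely generated group $G$ with a computable left-order (resp. bi-order) such that membership in the image of $H$ is decidable in $G$. Moreover, for every left-order (resp. bi-order) $\preceq_H$ on $H$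 that is computable with respect to some generating sequence of $H$, the embedding in (iii), and hence also in (ii), can be chosen such that the computable left-order (resp. bi-order) on $G$ continues $\preceq_H$, i.e. restricts to $\preceq_H$ on the image of $H$. -/

import Mathlib

universe u

/-- The element represented by a word in the letters `x i` and `(x i)⁻¹`: the letter `(i, true)`
stands for `x i` and `(i, false)` for `(x i)⁻¹`. -/
def wordValue {ι G : Type*} [Group G] (x : ι → G) (w : List (ι × Bool)) : G :=
  (w.map fun p => cond p.2 (x p.1) (x p.1)⁻¹).prod

/-- The family `x` generates the group `G`. -/
def GeneratesGroup {ι G : Type*} [Group G] (x : ι → G) : Prop :=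
  Subgroup.closure (Set.range x) = ⊤

/-- `r` (read `r a b` as `a ≼ b`) is a linear order on `G` invariant under left multiplication. -/
structure IsLeftOrder {G : Type*} [Group G] (r : G → G → Prop) : Prop where
  isLinearOrder : IsLinearOrder G r
  mul_left : ∀ c a b, r a b → r (c * a) (c * b)

/-- A left-order that is also invariant under right multiplication. -/
structure IsBiOrder {G : Type*} [Group G] (r : G → G → Prop) : Prop extends IsLeftOrder r where
  mul_right : ∀ c a b, r a b → r (a * c) (b * c)

/-- The relation `r` on `G` is computable with respect to the family `x`: it is decidable, given
two words in the letters `x i`, `(x i)⁻¹`, whether the elements they represent are related. -/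
def IsComputableOrder {ι G : Type*} [Primcodable ι] [Group G] (x : ι → G)
    (r : G → G → Prop) : Prop :=
  ComputablePred fun p : List (ι × Bool) × List (ι × Bool) =>
    r (wordValue x p.1) (wordValue x p.2)

/-- The membership problem for `K` is decidable with respect to the family `x`: it is decidable,
given a word in the letters `x i`, `(x i)⁻¹`, whether the element it represents lies in `K`. -/
def HasDecidableMembership {ι G : Type*} [Primcodable ι] [Group G] (x : ι → G)
    (K : Subgroup G) : Prop :=
  ComputablePred fun w : List (ι × Bool) => wordValue x w ∈ K

/-- `r` is a computable left-order on `G` with respect to the generating sequence `x`. Repetitions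
are allowed, so finite generating sets are included. -/
structure IsComputableLeftOrder {ι G : Type*} [Primcodable ι] [Group G] (x : ι → G)
    (r : G → G → Prop) : Prop where
  generates : GeneratesGroup x
  isLeftOrder : IsLeftOrder r
  computable : IsComputableOrder x r

/-- `r` is a computable bi-order on `G` with respect to the generating sequence `x`. Repetitions
are allowed, so finite generating sets are included. -/
structure IsComputableBiOrder {ι G : Type*} [Primcodable ι] [Group G] (x : ι → G)
    (r : G → G → Prop) : Prop where
  generates : GeneratesGroup x
  isBiOrder : IsBiOrder r
  computable : IsComputableOrder x r

/-! From `G` to `H`: decidable membership turns the words over the generators of `G` into a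
computable sequence of words that represent exactly the elements of `H`, and the order is pulled
back along it (`exists_isComputableOrder_comap`).

From `H` to `G`, one embedding serves all claims (`exists_subnormal_embedding`). Let W(A) be the
wreath product `ShiftWreath A`, ordered lexicographically; this order is a left-order, or a
bi-order, along with that of A, and continues it on the copy of A at position 0. In W(H) let t be
the translation and f_i the function that is x_i on [0, ∞). Put b_0 = t and b_{i+1} = f_i t; then
[b_{i+1}, b_0] is x_i at position 0. In W(W(H)) let F be the function with F(2^i) = b_i. The
translates of F by -1 and -2^(i+1) have supports that meet only at 0, so their commutator is
[b_{i+1}, b_0] at 0. Hence F and the translation generate a group G that contains H. The copy of A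
is normal in the kernel of W(A) → ℤ, so H is subnormal in W(W(H)) and therefore in G.

The value of a word at a position is computed as a word one level down, and its sign is decided
there. Finitely many positions suffice (`IsWindow`): over the b_i the values are eventually
constant; over F and the translation the value at 2^i + a is, for large i, a power of b_i whose
exponent does not depend on i, and since every b_i has infinite order a single i decides whether the
exponent vanishes. -/

/-- The group of pairs `(f, m)` of a function `f : ℤ → A` whose support is bounded below and an
integer `m`, which acts by translation: the wreath product of `A` and `ℤ` with such functions. -/
@[ext] structure ShiftWreath (A : Type u) [One A] where
  val : ℤ → A
  shift : ℤ
  exists_lt_val_eq_one : ∃ N, ∀ p < N, val p = 1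

/-! ### The wreath product and its copy of `A`. -/

namespace ShiftWreath

variable {A : Type u} [Group A]

instance : Mul (ShiftWreath A) where
  mul g h :=
    { val := fun p => g.val p * h.val (p - g.shift)
      shift := g.shift + h.shift
      exists_lt_val_eq_one := by
        obtain ⟨M, hM⟩ := g.exists_lt_val_eq_one
        obtain ⟨N, hN⟩ := h.exists_lt_val_eq_one
        refine ⟨min M (N + g.shift), fun p hp => ?_⟩
        rw [hM p (by omega), hN _ (by omega), one_mul] }

instance : One (ShiftWreath A) where
  one := { val := 1, shift := 0, exists_lt_val_eq_one := ⟨0, fun _ _ => rfl⟩ }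

instance : Inv (ShiftWreath A) where
  inv g :=
    { val := fun p => (g.val (p + g.shift))⁻¹
      shift := -g.shift
      exists_lt_val_eq_one := by
        obtain ⟨M, hM⟩ := g.exists_lt_val_eq_one
        exact ⟨M - g.shift, fun p hp => by rw [hM _ (by omega), inv_one]⟩ }

@[simp] lemma mul_val (g h : ShiftWreath A) (p : ℤ) :
    (g * h).val p = g.val p * h.val (p - g.shift) := rfl
@[simp] lemma mul_shift (g h : ShiftWreath A) : (g * h).shift = g.shift + h.shift := rfl
@[simp] lemma one_val (p : ℤ) : (1 : ShiftWreath A).val p = 1 := rfl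
@[simp] lemma one_shift : (1 : ShiftWreath A).shift = 0 := rfl
@[simp] lemma inv_val (g : ShiftWreath A) (p : ℤ) :
    g⁻¹.val p = (g.val (p + g.shift))⁻¹ := rfl
@[simp] lemma inv_shift (g : ShiftWreath A) : g⁻¹.shift = -g.shift := rfl

lemma ext_val {g h : ShiftWreath A} (hs : g.shift = h.shift) (hv : ∀ p, g.val p = h.val p) :
    g = h :=
  ShiftWreath.ext (funext hv) hs

instance : Group (ShiftWreath A) :=
  Group.ofLeftAxioms
    (fun a b c => ext_val (by simp [add_assoc]) fun p => by simp [mul_assoc, sub_sub])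
    (fun a => ext_val (by simp) fun p => by simp)
    (fun a => ext_val (by simp) fun p => by simp)

/-- The projection to `ℤ`. -/
def shiftHom : ShiftWreath A →* Multiplicative ℤ where
  toFun g := Multiplicative.ofAdd g.shift
  map_one' := rfl
  map_mul' _ _ := rfl

lemma mem_ker_shiftHom {g : ShiftWreath A} : g ∈ (shiftHom (A := A)).ker ↔ g.shift = 0 :=
  Iff.rfl

/-- The copy of `A` at position `0`. -/
def single : A →* ShiftWreath A where
  toFun a :=
    { val := fun p => if p = 0 then a else 1
      shift := 0
      exists_lt_val_eq_one := ⟨0, fun p hp => if_neg hp.ne⟩ }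
  map_one' := ext_val rfl fun p => by simp
  map_mul' a b := ext_val (by simp) fun p => by
    by_cases hp : p = 0 <;> simp [hp]

@[simp] lemma single_shift (a : A) : (single a).shift = 0 := rfl
lemma single_val (a : A) (p : ℤ) : (single a).val p = if p = 0 then a else 1 := rfl
@[simp] lemma single_val_zero (a : A) : (single a).val 0 = a := rfl

lemma single_injective : Function.Injective (single (A := A)) := fun a b h => by
  simpa using congrArg (fun g => g.val 0) h

lemma mem_map_single {K : Subgroup A} {g : ShiftWreath A} :
    g ∈ K.map single ↔ g.shift = 0 ∧ (∀ p, p ≠ 0 → g.val p = 1) ∧ g.val 0 ∈ K := by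
  constructor
  · rintro ⟨a, ha, rfl⟩
    exact ⟨rfl, fun p hp => by simp [single_val, hp], ha⟩
  · rintro ⟨hs, hv, hK⟩
    refine ⟨g.val 0, hK, ext_val hs.symm fun p => ?_⟩
    by_cases hp : p = 0
    · simp [hp]
    · rw [hv p hp, single_val, if_neg hp]

/-- A subnormal chain of `K` is mapped into the copy of `A` and prolonged by the kernel of
`shiftHom`. There multiplication is pointwise, so conjugation does not enlarge supports. -/
lemma isSubnormal_map_single {K : Subgroup A} (hK : K.IsSubnormal) :
    (K.map single).IsSubnormal := by
  induction hK with
  | top =>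
    have hle : (⊤ : Subgroup A).map single ≤ (shiftHom (A := A)).ker := fun g hg =>
      (mem_map_single.1 hg).1
    refine .step _ _ hle (Subgroup.Normal.isSubnormal inferInstance) ?_
    rw [Subgroup.normal_subgroupOf_iff hle]
    intro h k hh hk
    rw [mem_ker_shiftHom] at hk
    rw [mem_map_single] at hh ⊢
    refine ⟨by simp [hh.1], fun p hp => ?_, Subgroup.mem_top _⟩
    simp [hh.1, hk, hh.2.1 p hp]
  | step K L hle _ hN ih =>
    rw [Subgroup.normal_subgroupOf_iff hle] at hN
    refine .step _ _ (Subgroup.map_mono hle) ih ?_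
    rw [Subgroup.normal_subgroupOf_iff (Subgroup.map_mono hle)]
    rintro _ _ ⟨a, ha, rfl⟩ ⟨b, hb, rfl⟩
    exact ⟨b * a * b⁻¹, hN a b ha hb, by simp⟩

/-! ### The lexicographic order. -/

/-- The lexicographic order: translations are compared first, then the values at the least position
at which the functions differ. -/
def lexLE (r : A → A → Prop) (g h : ShiftWreath A) : Prop :=
  g.shift < h.shift ∨ g.shift = h.shift ∧
    ((∀ p, g.val p = h.val p) ∨
      ∃ p, (∀ p' < p, g.val p' = h.val p') ∧ g.val p ≠ h.val p ∧ r (g.val p) (h.val p))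

/-- Supports are bounded below for this purpose: far to the left both functions are 1. -/
lemma exists_first_ne {g h : ShiftWreath A} (hne : ∃ p, g.val p ≠ h.val p) :
    ∃ p, (∀ p' < p, g.val p' = h.val p') ∧ g.val p ≠ h.val p := by
  obtain ⟨M, hM⟩ := g.exists_lt_val_eq_one
  obtain ⟨N, hN⟩ := h.exists_lt_val_eq_one
  obtain ⟨p, hp, hmin⟩ := Int.exists_least_of_bdd (P := fun p => g.val p ≠ h.val p)
    ⟨min M N, fun p hp => by
      by_contra hlt
      exact hp (by rw [hM p (by omega), hN p (by omega)])⟩ hne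
  refine ⟨p, fun p' hp' => ?_, hp⟩
  by_contra hne'
  exact absurd (hmin p' hne') (by omega)

lemma lexLE_single {r : A → A → Prop} (hr : ∀ a, r a a) (a b : A) :
    lexLE r (single a) (single b) ↔ r a b := by
  constructor
  · rintro (h | ⟨-, h | ⟨p, -, hne, h⟩⟩)
    · exact absurd h (by simp)
    · have := h 0
      simp only [single_val_zero] at this
      exact this ▸ hr a
    · by_cases hp : p = 0
      · simpa [hp] using h
      · exact absurd (by simp [single_val, hp]) hne
  · intro h
    refine Or.inr ⟨rfl, ?_⟩
    by_cases hab : a = b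
    · exact Or.inl fun p => by rw [hab]
    · exact Or.inr ⟨0, fun p hp => by simp [single_val, hp.ne], by simpa using hab, by simpa using h⟩

lemma isLinearOrder_lexLE {r : A → A → Prop} (hr : IsLinearOrder A r) :
    IsLinearOrder (ShiftWreath A) (lexLE r) := by
  have htrans : ∀ {a b c}, r a b → r b c → r a c := fun h h' => hr.trans _ _ _ h h'
  have hanti : ∀ {a b}, r a b → r b a → a = b := fun h h' => hr.antisymm _ _ h h'
  refine { refl := fun g => Or.inr ⟨rfl, Or.inl fun p => rfl⟩, trans := ?_, antisymm := ?_, total := ?_ }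
  · rintro f g h (h1 | ⟨h1, h1'⟩) (h2 | ⟨h2, h2'⟩)
    · exact Or.inl (h1.trans h2)
    · exact Or.inl (h2 ▸ h1)
    · exact Or.inl (h1 ▸ h2)
    refine Or.inr ⟨h1.trans h2, ?_⟩
    rcases h1' with h1' | ⟨p, hp, hpne, hpr⟩
    · simpa only [h1'] using h2'
    rcases h2' with h2' | ⟨q, hq, hqne, hqr⟩
    · simp only [← h2']
      exact Or.inr ⟨p, hp, hpne, hpr⟩
    right
    rcases lt_trichotomy p q with hlt | rfl | hlt
    · refine ⟨p, fun p' hp' => (hp p' hp').trans (hq p' (hp'.trans hlt)), ?_, ?_⟩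
      · rwa [← hq p hlt]
      · rwa [← hq p hlt]
    · refine ⟨p, fun p' hp' => (hp p' hp').trans (hq p' hp'), fun heq => hpne ?_, htrans hpr hqr⟩
      rw [← heq] at hqr
      exact hanti hpr hqr
    · refine ⟨q, fun p' hp' => (hp p' (hp'.trans hlt)).trans (hq p' hp'), ?_, ?_⟩
      · rwa [hp q hlt]
      · rwa [hp q hlt]
  · rintro g h (h1 | ⟨h1, h1'⟩) (h2 | ⟨h2, h2'⟩)
    · exact absurd h1 h2.not_gt
    · exact absurd h2 h1.ne'
    · exact absurd h1 h2.ne'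
    refine ext_val h1 ?_
    rcases h1' with h1' | ⟨p, hp, hpne, hpr⟩
    · exact h1'
    rcases h2' with h2' | ⟨q, hq, hqne, hqr⟩
    · exact fun p => (h2' p).symm
    exfalso
    rcases lt_trichotomy p q with hlt | rfl | hlt
    · exact hpne (hq p hlt).symm
    · exact hpne (hanti hpr hqr)
    · exact hqne (hp q hlt).symm
  · intro g h
    rcases lt_trichotomy g.shift h.shift with hlt | heq | hlt
    · exact Or.inl (Or.inl hlt)
    · by_cases hne : ∃ p, g.val p ≠ h.val p
      · obtain ⟨p, hp, hpne⟩ := exists_first_ne hne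
        rcases hr.total (g.val p) (h.val p) with hr' | hr'
        · exact Or.inl (Or.inr ⟨heq, Or.inr ⟨p, hp, hpne, hr'⟩⟩)
        · exact Or.inr (Or.inr ⟨heq.symm, Or.inr ⟨p, fun p' hp' => (hp p' hp').symm, hpne.symm, hr'⟩⟩)
      · exact Or.inl (Or.inr ⟨heq, Or.inl fun p => not_not.1 fun h' => hne ⟨p, h'⟩⟩)
    · exact Or.inr (Or.inl hlt)

lemma isLeftOrder_lexLE {r : A → A → Prop} (hr : IsLeftOrder r) : IsLeftOrder (lexLE r) where
  isLinearOrder := isLinearOrder_lexLE hr.isLinearOrder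
  mul_left k g h := by
    rintro (hlt | ⟨hs, hv | ⟨p, hp, hne, hpr⟩⟩)
    · exact Or.inl (by simpa using hlt)
    · exact Or.inr ⟨by simp [hs], Or.inl fun p => by simp [hv]⟩
    -- A left factor moves both functions by `k.shift`, and the first difference moves along.
    · refine Or.inr ⟨by simp [hs], Or.inr ⟨p + k.shift, fun p' hp' => ?_, ?_, ?_⟩⟩
      · simp [hp (p' - k.shift) (by omega)]
      · simpa using hne
      · simpa using hr.mul_left _ _ _ hpr

lemma isBiOrder_lexLE {r : A → A → Prop} (hr : IsBiOrder r) : IsBiOrder (lexLE r) where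
  toIsLeftOrder := isLeftOrder_lexLE hr.toIsLeftOrder
  mul_right k g h := by
    rintro (hlt | ⟨hs, hv | ⟨p, hp, hne, hpr⟩⟩)
    · exact Or.inl (by simpa using hlt)
    · exact Or.inr ⟨by simp [hs], Or.inl fun p => by simp [hv, hs]⟩
    -- A right factor moves neither function; as the shifts agree, both are multiplied by the same
    -- translate of `k.val`.
    · refine Or.inr ⟨by simp [hs], Or.inr ⟨p, fun p' hp' => ?_, ?_, ?_⟩⟩
      · simp [hp p' hp', hs]
      · simpa [hs] using hne
      · simpa [hs] using hr.mul_right _ _ _ hpr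

end ShiftWreath

/-! ### Words and their values. -/

section Words

variable {ι G : Type*} [Group G] (x : ι → G)

@[simp] lemma wordValue_nil : wordValue x [] = 1 := rfl

@[simp] lemma wordValue_cons (p : ι × Bool) (w : List (ι × Bool)) :
    wordValue x (p :: w) = cond p.2 (x p.1) (x p.1)⁻¹ * wordValue x w := by
  simp [wordValue]

@[simp] lemma wordValue_append (v w : List (ι × Bool)) :
    wordValue x (v ++ w) = wordValue x v * wordValue x w := by
  simp [wordValue]

/-- The formal inverse of a word. -/
def invWord (w : List (ι × Bool)) : List (ι × Bool) :=
  (w.map fun p => (p.1, !p.2)).reverse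

@[simp] lemma wordValue_invWord (w : List (ι × Bool)) :
    wordValue x (invWord w) = (wordValue x w)⁻¹ := by
  induction w with
  | nil => simp [invWord]
  | cons p w ih =>
    have : invWord (p :: w) = invWord w ++ [(p.1, !p.2)] := by simp [invWord]
    rw [this, wordValue_append, ih]
    obtain ⟨i, _ | _⟩ := p <;> simp

lemma primrec_invWord [Primcodable ι] : Primrec (invWord (ι := ι)) := by
  refine Primrec.list_reverse.comp (Primrec.list_map .id (Primrec.pair ?_ ?_))
  · exact Primrec.fst.comp .snd
  · exact Primrec.not.comp (Primrec.snd.comp .snd)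

lemma map_wordValue {K : Type*} [Group K] (f : G →* K) (w : List (ι × Bool)) :
    f (wordValue x w) = wordValue (fun i => f (x i)) w := by
  induction w with
  | nil => simp
  | cons p w ih => obtain ⟨i, _ | _⟩ := p <;> simp [ih]

lemma exists_wordValue_eq (hx : GeneratesGroup x) (g : G) : ∃ w, wordValue x w = g := by
  have hg : g ∈ Subgroup.closure (Set.range x) := hx ▸ Subgroup.mem_top g
  induction hg using Subgroup.closure_induction with
  | mem g hg =>
    obtain ⟨i, rfl⟩ := hg
    exact ⟨[(i, true)], by simp⟩
  | one => exact ⟨[], rfl⟩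
  | mul g h _ _ ihg ihh =>
    obtain ⟨v, rfl⟩ := ihg
    obtain ⟨w, rfl⟩ := ihh
    exact ⟨v ++ w, wordValue_append x v w⟩
  | inv g _ ih =>
    obtain ⟨w, rfl⟩ := ih
    exact ⟨invWord w, wordValue_invWord x w⟩

/-- By left invariance, comparing u with v is comparing 1 with u⁻¹v. -/
lemma isComputableOrder_of_one_le [Primcodable ι] {r : G → G → Prop} (hr : IsLeftOrder r)
    (h : ComputablePred fun w => r 1 (wordValue x w)) : IsComputableOrder x r := by
  have hc : Computable fun p : List (ι × Bool) × List (ι × Bool) => invWord p.1 ++ p.2 :=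
    Computable.list_append.comp (primrec_invWord.to_comp.comp .fst) .snd
  obtain ⟨f, hf, hfr⟩ := ComputablePred.computable_iff.1 h
  refine ComputablePred.computable_iff.2 ⟨_, hf.comp hc, funext fun p => propext ?_⟩
  have := congrFun hfr (invWord p.1 ++ p.2)
  rw [← this, wordValue_append, wordValue_invWord]
  constructor
  · intro h
    simpa using hr.mul_left (wordValue x p.1)⁻¹ _ _ h
  · intro h
    simpa using hr.mul_left (wordValue x p.1) _ _ h

end Words

/-! ### Bounded search. -/

section FirstNonzero

/-- The first nonzero value among `f 0, …, f (n - 1)`, or `0` if there is none. -/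
def firstNonzero (f : ℕ → ℕ) (n : ℕ) : ℕ :=
  Nat.rec 0 (fun k s => bif s == 0 then f k else s) n

lemma firstNonzero_spec (f : ℕ → ℕ) (n : ℕ) :
    ((∀ k < n, f k = 0) ∧ firstNonzero f n = 0) ∨
      ∃ k < n, (∀ k' < k, f k' = 0) ∧ f k ≠ 0 ∧ firstNonzero f n = f k := by
  induction n with
  | zero => exact Or.inl ⟨by simp, rfl⟩
  | succ n ih =>
    have hsucc : firstNonzero f (n + 1) =
      bif firstNonzero f n == 0 then f n else firstNonzero f n := rfl
    rcases ih with ⟨h0, hs⟩ | ⟨k, hk, h0, hne, hs⟩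
    · rw [hs] at hsucc
      by_cases hn : f n = 0
      · refine Or.inl ⟨fun k hk => ?_, by simpa [hn] using hsucc⟩
        rcases Nat.lt_succ_iff_lt_or_eq.1 hk with hk | rfl
        exacts [h0 k hk, hn]
      · exact Or.inr ⟨n, n.lt_succ_self, h0, hn, by simpa using hsucc⟩
    · refine Or.inr ⟨k, hk.trans n.lt_succ_self, h0, hne, ?_⟩
      rw [hsucc, hs, beq_false_of_ne hne, cond_false]

lemma firstNonzero_eq_zero_iff {f : ℕ → ℕ} {n : ℕ} :
    firstNonzero f n = 0 ↔ ∀ k < n, f k = 0 := by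
  rcases firstNonzero_spec f n with ⟨h0, hs⟩ | ⟨k, hk, -, hne, hs⟩
  · exact iff_of_true hs h0
  · rw [hs]
    exact ⟨fun h => absurd h hne, fun h => h k hk⟩

lemma computable_firstNonzero {α : Type*} [Primcodable α] {f : α → ℕ → ℕ} {n : α → ℕ}
    (hf : Computable₂ f) (hn : Computable n) : Computable fun a => firstNonzero (f a) (n a) := by
  have hs : Computable fun p : α × ℕ × ℕ => p.2.2 := Computable.snd.comp .snd
  exact Computable.nat_rec (h := fun a p => bif p.2 == 0 then f a p.1 else p.2) hn (.const 0)
    (Computable.cond ((Primrec.beq (α := ℕ)).to_comp.comp hs (.const 0))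
      (hf.comp .fst (Computable.fst.comp .snd)) hs).to₂

end FirstNonzero

lemma computable_flatMap {α β : Type*} [Primcodable α] [Primcodable β] {f : α → List β}
    (hf : Computable f) : Computable fun l : List α => l.flatMap f := by
  have key : ∀ (l : List α) (n : ℕ), (Nat.rec [] (fun k s => s ++ ((l[k]?).map f).getD []) n :
      List β) = (l.take n).flatMap f := by
    intro l n
    induction n with
    | zero => simp
    | succ n ih =>
      rw [List.take_add_one, List.flatMap_append, ← ih]
      cases h : l[n]? <;> simp [h]
  refine Computable.of_eq (f := fun l : List α =>
    (Nat.rec [] (fun k s => s ++ ((l[k]?).map f).getD []) l.length : List β)) ?_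
    fun l => by rw [key, List.take_length]
  refine Computable.nat_rec (h := fun l p => p.2 ++ ((l[p.1]?).map f).getD [])
    Computable.list_length (.const []) ?_
  refine Computable.list_append.comp (Computable.snd.comp .snd) (Computable.option_getD ?_ (.const []))
  exact Computable.option_map (Computable.list_getElem?.comp .fst (Computable.fst.comp .snd))
    (hf.comp .snd).to₂

/-! ### Evaluation of words at a position. -/

namespace ShiftWreath

variable {ι κ : Type*} {A : Type u} [Group A]

/-- The family `y` in the wreath product is given by the words `w j p` over `x` for the values at
the positions `p ≥ 0` and by the translations `e j ∈ {0, 1}`. -/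
structure IsGivenBy [Primcodable ι] [Primcodable κ] (y : κ → ShiftWreath A) (x : ι → A)
    (w : κ → ℕ → List (ι × Bool)) (e : κ → ℕ) : Prop where
  val_natCast : ∀ (j : κ) (p : ℕ), (y j).val p = wordValue x (w j p)
  val_neg : ∀ (j : κ) (p : ℤ), p < 0 → (y j).val p = 1
  shift_eq : ∀ j, (y j).shift = e j
  shift_le : ∀ j, e j ≤ 1
  primrec_word : Primrec₂ w
  primrec_shift : Primrec e

/-- A word for the value at the position `a - b`. -/
def letterWord (w : κ → ℕ → List (ι × Bool)) (j : κ) (a b : ℕ) : List (ι × Bool) :=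
  if b ≤ a then w j (a - b) else []

/-- One step in the evaluation of a word at a position, which is the difference of the two numbers
that are the first component of the state. -/
def evalStep (w : κ → ℕ → List (ι × Bool)) (e : κ → ℕ) (s : (ℕ × ℕ) × List (ι × Bool))
    (l : κ × Bool) : (ℕ × ℕ) × List (ι × Bool) :=
  bif l.2 then ((s.1.1, s.1.2 + e l.1), s.2 ++ letterWord w l.1 s.1.1 s.1.2)
  else ((s.1.1 + e l.1, s.1.2), s.2 ++ invWord (letterWord w l.1 (s.1.1 + e l.1) s.1.2))

/-- The evaluation of a word at the position `a - b`. -/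
def evalWord (w : κ → ℕ → List (ι × Bool)) (e : κ → ℕ) (u : List (κ × Bool)) (a b : ℕ) :
    (ℕ × ℕ) × List (ι × Bool) :=
  u.foldl (evalStep w e) ((a, b), [])

namespace IsGivenBy

variable [Primcodable ι] [Primcodable κ] {y : κ → ShiftWreath A} {x : ι → A}
  {w : κ → ℕ → List (ι × Bool)} {e : κ → ℕ} (hy : IsGivenBy y x w e)
include hy

lemma wordValue_letterWord (j : κ) (a b : ℕ) :
    wordValue x (letterWord w j a b) = (y j).val (a - b) := by
  unfold letterWord
  split_ifs with h
  · rw [← hy.val_natCast, Nat.cast_sub h]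
  · rw [hy.val_neg _ _ (by omega), wordValue_nil]

/-- The part of the word already read has moved the position by minus its translation, so the final
position also reveals the total shift. -/
lemma foldl_evalStep (u : List (κ × Bool)) (s : (ℕ × ℕ) × List (ι × Bool)) :
    wordValue x (u.foldl (evalStep w e) s).2 =
        wordValue x s.2 * (wordValue y u).val (s.1.1 - s.1.2) ∧
      ((u.foldl (evalStep w e) s).1.1 : ℤ) - (u.foldl (evalStep w e) s).1.2 =
        s.1.1 - s.1.2 - (wordValue y u).shift := by
  induction u generalizing s with
  | nil => simp
  | cons l u ih =>
    obtain ⟨j, _ | _⟩ := l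
    · rw [List.foldl_cons]
      refine ⟨(ih _).1.trans ?_, (ih _).2.trans ?_⟩
      · simp [evalStep, hy.wordValue_letterWord, hy.shift_eq, mul_assoc, sub_add_eq_add_sub]
      · simp [evalStep, hy.shift_eq]
        ring
    · rw [List.foldl_cons]
      refine ⟨(ih _).1.trans ?_, (ih _).2.trans ?_⟩
      · simp [evalStep, hy.wordValue_letterWord, hy.shift_eq, mul_assoc, sub_sub]
      · simp [evalStep, hy.shift_eq]
        ring

lemma wordValue_evalWord (u : List (κ × Bool)) (a b : ℕ) :
    wordValue x (evalWord w e u a b).2 = (wordValue y u).val (a - b) := by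
  simpa [evalWord] using (hy.foldl_evalStep u ((a, b), [])).1

lemma evalWord_shift (u : List (κ × Bool)) (a b : ℕ) :
    ((evalWord w e u a b).1.1 : ℤ) - (evalWord w e u a b).1.2 = a - b - (wordValue y u).shift :=
  (hy.foldl_evalStep u ((a, b), [])).2

/-- The generators are supported on `[0, ∞)` and each letter moves the position by at most 1. -/
lemma val_eq_one_of_lt (u : List (κ × Bool)) (p : ℤ) (hp : p < -(u.length : ℤ)) :
    (wordValue y u).val p = 1 := by
  induction u generalizing p with
  | nil => simp
  | cons l u ih =>
    obtain ⟨j, b⟩ := l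
    have h1 := hy.shift_le j
    rw [List.length_cons] at hp
    cases b
    · simp only [wordValue_cons, cond_false, mul_val, inv_val, inv_shift, hy.shift_eq]
      rw [hy.val_neg _ _ (by omega), ih _ (by omega), inv_one, one_mul]
    · simp only [wordValue_cons, cond_true, mul_val, hy.shift_eq]
      rw [hy.val_neg _ _ (by omega), ih _ (by omega), one_mul]

lemma primrec_letterWord : Primrec fun p : κ × ℕ × ℕ => letterWord w p.1 p.2.1 p.2.2 := by
  have ha : Primrec fun p : κ × ℕ × ℕ => p.2.1 := Primrec.fst.comp .snd
  have hb : Primrec fun p : κ × ℕ × ℕ => p.2.2 := Primrec.snd.comp .snd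
  exact Primrec.ite (Primrec.nat_le.comp hb ha)
    (hy.primrec_word.comp .fst (Primrec.nat_sub.comp ha hb)) (.const [])

lemma primrec_evalStep : Primrec₂ (evalStep w e) := by
  have hj : Primrec fun p : ((ℕ × ℕ) × List (ι × Bool)) × κ × Bool => p.2.1 :=
    Primrec.fst.comp .snd
  have ha : Primrec fun p : ((ℕ × ℕ) × List (ι × Bool)) × κ × Bool => p.1.1.1 :=
    Primrec.fst.comp (Primrec.fst.comp .fst)
  have hb : Primrec fun p : ((ℕ × ℕ) × List (ι × Bool)) × κ × Bool => p.1.1.2 :=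
    Primrec.snd.comp (Primrec.fst.comp .fst)
  have hs : Primrec fun p : ((ℕ × ℕ) × List (ι × Bool)) × κ × Bool => p.1.2 :=
    Primrec.snd.comp .fst
  have he := hy.primrec_shift.comp hj
  have hae := Primrec.nat_add.comp ha he
  refine Primrec.cond (Primrec.snd.comp .snd)
    ((ha.pair (Primrec.nat_add.comp hb he)).pair (Primrec.list_append.comp hs ?_))
    ((hae.pair hb).pair (Primrec.list_append.comp hs (primrec_invWord.comp ?_)))
  · exact hy.primrec_letterWord.comp (hj.pair (ha.pair hb))
  · exact hy.primrec_letterWord.comp (hj.pair (hae.pair hb))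

lemma primrec_evalWord : Primrec fun p : List (κ × Bool) × ℕ × ℕ => evalWord w e p.1 p.2.1 p.2.2 :=
  Primrec.list_foldl .fst (Primrec.snd.pair (.const []))
    (hy.primrec_evalStep.comp (Primrec.fst.comp .snd) (Primrec.snd.comp .snd)).to₂

end IsGivenBy

/-! ### Decision procedures from a finite window. -/

/-- `N` bounds the positions that decide whether all values at positive positions are trivial. -/
def IsWindow (y : κ → ShiftWreath A) (N : List (κ × Bool) → ℕ) : Prop :=
  ∀ u, (∀ p : ℤ, 0 < p → p ≤ N u → (wordValue y u).val p = 1) →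
    ∀ p : ℤ, N u < p → (wordValue y u).val p = 1

/-- The codes 0, 1, 2 stand for trivial, positive and negative, so that `firstNonzero` returns the
sign of the first nontrivial value. -/
lemma exists_computable_sign [Primcodable ι] {x : ι → A} {r : A → A → Prop} (hr : IsLeftOrder r)
    (hc : IsComputableOrder x r) : ∃ σ : List (ι × Bool) → ℕ, Computable σ ∧
      ∀ v, (σ v = 0 ↔ wordValue x v = 1) ∧ (σ v ≠ 2 ↔ r 1 (wordValue x v)) := by
  obtain ⟨f, hf, hfr⟩ := ComputablePred.computable_iff.1 hc
  have hfr : ∀ u v, r (wordValue x u) (wordValue x v) ↔ f (u, v) = true := fun u v =>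
    iff_of_eq (congrFun hfr (u, v))
  refine ⟨fun v => bif f ([], v) then (bif f (v, []) then 0 else 1) else 2, ?_, fun v => ?_⟩
  · exact .cond (hf.comp ((Computable.const []).pair .id))
      (.cond (hf.comp (Computable.id.pair (.const []))) (.const 0) (.const 1)) (.const 2)
  · have h1 := hfr [] v
    have h2 := hfr v []
    rw [wordValue_nil] at h1 h2
    have hL := hr.isLinearOrder
    have h3 : wordValue x v = 1 ↔ r 1 (wordValue x v) ∧ r (wordValue x v) 1 :=
      ⟨fun h => by rw [h]; exact ⟨hL.refl _, hL.refl _⟩, fun h => hL.antisymm _ _ h.2 h.1⟩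
    rw [h3, h1, h2]
    beta_reduce
    cases f ([], v) <;> cases f (v, []) <;> simp

namespace IsGivenBy

variable [Primcodable ι] [Primcodable κ] {y : κ → ShiftWreath A} {x : ι → A}
  {w : κ → ℕ → List (ι × Bool)} {e : κ → ℕ} {N : List (κ × Bool) → ℕ} {r : A → A → Prop}

lemma computable_evalWord_val (hy : IsGivenBy y x w e) {σ : List (ι × Bool) → ℕ}
    (hσ : Computable σ) : Computable₂ fun (u : List (κ × Bool)) (k : ℕ) =>
      σ (evalWord w e u k u.length).2 :=
  hσ.comp (Computable.snd.comp (hy.primrec_evalWord.comp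
    (Primrec.fst.pair (Primrec.snd.pair (Primrec.list_length.comp .fst)))).to_comp)

/-- The index `k` stands for the position `k - u.length`. Position 0 is left out because membership
in `K.map single` allows any element of `K` there. -/
lemma val_eq_one_of_window (hy : IsGivenBy y x w e) (hN : IsWindow y N) (u : List (κ × Bool))
    (h : ∀ k < u.length + N u + 1, k ≠ u.length → (wordValue y u).val (k - u.length) = 1)
    (p : ℤ) (hp : p ≠ 0) : (wordValue y u).val p = 1 := by
  have hmid : ∀ p : ℤ, p ≠ 0 → -(u.length : ℤ) ≤ p → p ≤ N u → (wordValue y u).val p = 1 := by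
    intro p hp h1 h2
    have := h (p + u.length).toNat (by omega) (by omega)
    rwa [Int.toNat_of_nonneg (by omega), add_sub_cancel_right] at this
  rcases lt_or_ge p (-(u.length : ℤ)) with h1 | h1
  · exact hy.val_eq_one_of_lt u p h1
  rcases le_or_gt p (N u) with h2 | h2
  · exact hmid p hp h1 h2
  · exact hN u (fun p hp hp' => hmid p hp.ne' (by omega) hp') p h2

lemma isComputableOrder_lexLE (hy : IsGivenBy y x w e) (hN : IsWindow y N) (hNc : Primrec N)
    (hr : IsLeftOrder r) (hc : IsComputableOrder x r) : IsComputableOrder y (lexLE r) := by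
  refine isComputableOrder_of_one_le y (isLeftOrder_lexLE hr) ?_
  obtain ⟨σ, hσ, hσr⟩ := exists_computable_sign hr hc
  have hlen : Primrec fun u : List (κ × Bool) => u.length := Primrec.list_length
  have hfst := computable_firstNonzero (hy.computable_evalWord_val hσ)
    (Primrec.succ.comp (Primrec.nat_add.comp hlen hNc)).to_comp
  have hsh : Computable fun u : List (κ × Bool) => (evalWord w e u 0 0).1 :=
    (Primrec.fst.comp (hy.primrec_evalWord.comp (Primrec.id.pair (.const (0, 0))))).to_comp
  -- The evaluation that starts at (0, 0) ends at a - b = -shift, so a < b means a positive shift.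
  -- The code differs from 2 when the first nontrivial value is positive or there is none.
  have hdec : Primrec fun t : (ℕ × ℕ) × ℕ => decide (t.1.1 < t.1.2 ∨ t.1.1 = t.1.2 ∧ t.2 ≠ 2) := by
    have h1 : Primrec fun t : (ℕ × ℕ) × ℕ => t.1.1 := Primrec.fst.comp .fst
    have h2 : Primrec fun t : (ℕ × ℕ) × ℕ => t.1.2 := Primrec.snd.comp .fst
    exact ((Primrec.nat_lt.comp h1 h2).or ((Primrec.eq.comp h1 h2).and
      (Primrec.eq.comp Primrec.snd (.const 2)).not)).decide
  refine ComputablePred.computable_iff.2 ⟨_, hdec.to_comp.comp (hsh.pair hfst), funext fun u =>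
    propext ?_⟩
  simp only [decide_eq_true_eq]
  have hshift := hy.evalWord_shift u 0 0
  have hval : ∀ k : ℕ, wordValue x (evalWord w e u k u.length).2 =
    (wordValue y u).val (k - u.length) := fun k => hy.wordValue_evalWord u k _
  have hzero : ∀ k : ℕ, σ (evalWord w e u k u.length).2 = 0 ↔
      (wordValue y u).val (k - u.length) = 1 := fun k => by rw [(hσr _).1, hval]
  unfold lexLE
  refine or_congr ?_ (and_congr ?_ ?_)
  · simp only [one_shift]; omega
  · simp only [one_shift]; omega
  simp only [one_val]
  rcases firstNonzero_spec (fun k => σ (evalWord w e u k u.length).2) (u.length + N u + 1) with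
    ⟨h0, hs⟩ | ⟨k, hk, h0, hne, hs⟩
  · refine iff_of_true (Or.inl fun p => ?_) (by rw [Nat.succ_eq_add_one, hs]; decide)
    by_cases hp : p = 0
    · have := (hzero _).1 (h0 u.length (by omega))
      rw [hp, ← this, sub_self]
    · exact (hy.val_eq_one_of_window hN u (fun k hk _ => (hzero k).1 (h0 k hk)) p hp).symm
  · rw [Nat.succ_eq_add_one, hs, (hσr _).2, hval]
    have hne' : 1 ≠ (wordValue y u).val (k - u.length) := fun h => hne ((hzero k).2 h.symm)
    have hlt : ∀ p : ℤ, p < k - u.length → 1 = (wordValue y u).val p := by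
      intro p hp
      rcases lt_or_ge p (-(u.length : ℤ)) with h1 | h1
      · exact (hy.val_eq_one_of_lt u p h1).symm
      · have := (hzero _).1 (h0 (p + u.length).toNat (by omega))
        rwa [Int.toNat_of_nonneg (by omega), add_sub_cancel_right, eq_comm] at this
    constructor
    · rintro (h | ⟨p, hp, hpne, hpr⟩)
      · exact absurd (h _) hne'
      · rcases lt_trichotomy p (k - u.length) with h | rfl | h
        · exact absurd (hlt p h) hpne
        · exact hpr
        · exact absurd (hp _ h) hne'
    · exact fun h => Or.inr ⟨_, hlt, hne', h⟩

lemma hasDecidableMembership_map_single (hy : IsGivenBy y x w e) (hN : IsWindow y N)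
    (hNc : Primrec N) (hr : IsLeftOrder r) (hc : IsComputableOrder x r) {K : Subgroup A}
    (hK : HasDecidableMembership x K) : HasDecidableMembership y (K.map single) := by
  obtain ⟨σ, hσ, hσr⟩ := exists_computable_sign hr hc
  obtain ⟨m, hm, hmK⟩ := ComputablePred.computable_iff.1 hK
  have hmK : ∀ v, wordValue x v ∈ K ↔ m v = true := fun v => iff_of_eq (congrFun hmK v)
  have hlen : Primrec fun u : List (κ × Bool) => u.length := Primrec.list_length
  -- The value at position 0 is masked here; `m` tests it separately.
  have hoff : Computable₂ fun (u : List (κ × Bool)) (k : ℕ) =>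
      bif k == u.length then 0 else σ (evalWord w e u k u.length).2 :=
    Computable.cond (Primrec.beq.comp Primrec.snd (hlen.comp .fst)).to_comp (.const 0)
      (hy.computable_evalWord_val hσ)
  have hfst := computable_firstNonzero hoff
    (Primrec.succ.comp (Primrec.nat_add.comp hlen hNc)).to_comp
  have hev : Computable fun u : List (κ × Bool) => evalWord w e u 0 0 :=
    (hy.primrec_evalWord.comp (Primrec.id.pair (.const (0, 0)))).to_comp
  have hdec : Primrec fun t : ((ℕ × ℕ) × ℕ) × Bool =>
      decide (t.1.1.1 = t.1.1.2 ∧ t.1.2 = 0 ∧ t.2 = true) := by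
    have h1 : Primrec fun t : ((ℕ × ℕ) × ℕ) × Bool => t.1.1.1 :=
      Primrec.fst.comp (Primrec.fst.comp .fst)
    have h2 : Primrec fun t : ((ℕ × ℕ) × ℕ) × Bool => t.1.1.2 :=
      Primrec.snd.comp (Primrec.fst.comp .fst)
    have h3 : Primrec fun t : ((ℕ × ℕ) × ℕ) × Bool => t.1.2 := Primrec.snd.comp .fst
    exact ((Primrec.eq.comp h1 h2).and ((Primrec.eq.comp h3 (.const 0)).and
      (Primrec.eq.comp Primrec.snd (.const true)))).decide
  refine ComputablePred.computable_iff.2 ⟨_, hdec.to_comp.comp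
    (((Computable.fst.comp hev).pair hfst).pair (hm.comp (Computable.snd.comp hev))), funext fun u =>
    propext ?_⟩
  simp only [decide_eq_true_eq]
  rw [mem_map_single, firstNonzero_eq_zero_iff, ← hmK, hy.wordValue_evalWord]
  have hshift := hy.evalWord_shift u 0 0
  have hzero : ∀ k : ℕ, σ (evalWord w e u k u.length).2 = 0 ↔
      (wordValue y u).val (k - u.length) = 1 := fun k => by
    rw [(hσr _).1, hy.wordValue_evalWord]
  refine and_congr (by omega) (and_congr ⟨fun h k _ => ?_, fun h => ?_⟩ (by simp))
  · by_cases hk : k = u.length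
    · simp [hk]
    · rw [beq_false_of_ne hk, cond_false, hzero]
      exact h (k - u.length) (by omega)
  · refine hy.val_eq_one_of_window hN u fun k hk hne => ?_
    have := h k hk
    rwa [beq_false_of_ne hne, cond_false, hzero] at this

end IsGivenBy

end ShiftWreath

namespace ShiftWreath

open scoped commutatorElement

variable {ι κ : Type*} {A : Type u} [Group A]

/-- The element with value `wordValue x (w p)` at the positions `p ≥ 0` and translation `m`. -/
def ofWords (x : ι → A) (w : ℕ → List (ι × Bool)) (m : ℤ) : ShiftWreath A where
  val p := if 0 ≤ p then wordValue x (w p.toNat) else 1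
  shift := m
  exists_lt_val_eq_one := ⟨0, fun p hp => if_neg (by omega)⟩

lemma ofWords_val (x : ι → A) (w : ℕ → List (ι × Bool)) (m p : ℤ) :
    (ofWords x w m).val p = if 0 ≤ p then wordValue x (w p.toNat) else 1 := rfl

@[simp] lemma ofWords_shift (x : ι → A) (w : ℕ → List (ι × Bool)) (m : ℤ) :
    (ofWords x w m).shift = m := rfl

lemma isGivenBy_ofWords [Primcodable ι] [Primcodable κ] (x : ι → A)
    {w : κ → ℕ → List (ι × Bool)} {e : κ → ℕ} (hw : Primrec₂ w) (he : Primrec e)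
    (hle : ∀ j, e j ≤ 1) : IsGivenBy (fun j => ofWords x (w j) (e j)) x w e where
  val_natCast j p := by simp [ofWords_val]
  val_neg j p hp := if_neg (by omega)
  shift_eq _ := rfl
  shift_le := hle
  primrec_word := hw
  primrec_shift := he

/-! ### The first level: `x i` as a commutator of elements of infinite order. -/

section Stairs

/-- The words that define `stairs`. -/
def stairsWord (j _p : ℕ) : List (ℕ × Bool) := if j = 0 then [] else [(j - 1, true)]

/-- The translation, followed by the products of the functions that are `x i` on `[0, ∞)` with the
translation. -/
def stairs (x : ℕ → A) (j : ℕ) : ShiftWreath A := ofWords x (stairsWord j) (1 : ℕ)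

lemma primrec_stairsWord : Primrec₂ stairsWord := by
  have hj : Primrec fun p : ℕ × ℕ => p.1 := .fst
  exact Primrec.ite (Primrec.eq.comp hj (.const 0)) (.const [])
    (Primrec.list_cons.comp ((Primrec.pred.comp hj).pair (.const true)) (.const []))

lemma isGivenBy_stairs (x : ℕ → A) : IsGivenBy (stairs x) x stairsWord fun _ => 1 :=
  isGivenBy_ofWords x primrec_stairsWord (.const 1) fun _ => le_rfl

lemma stairs_val_zero (x : ℕ → A) (p : ℤ) : (stairs x 0).val p = 1 := by
  simp [stairs, ofWords_val, stairsWord]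

lemma stairs_val_succ (x : ℕ → A) (i : ℕ) (p : ℤ) :
    (stairs x (i + 1)).val p = if 0 ≤ p then x i else 1 := by
  simp [stairs, ofWords_val, stairsWord]

@[simp] lemma stairs_shift (x : ℕ → A) (j : ℕ) : (stairs x j).shift = 1 := rfl

lemma stairs_val_add_one (x : ℕ → A) (j : ℕ) (p : ℤ) (hp : 0 ≤ p) :
    (stairs x j).val (p + 1) = (stairs x j).val p := by
  cases j with
  | zero => rw [stairs_val_zero, stairs_val_zero]
  | succ i => rw [stairs_val_succ, stairs_val_succ, if_pos hp, if_pos (by omega)]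

lemma wordValue_stairs_val_add_one (x : ℕ → A) (u : List (ℕ × Bool)) (p : ℤ)
    (hp : (u.length : ℤ) ≤ p) :
    (wordValue (stairs x) u).val (p + 1) = (wordValue (stairs x) u).val p := by
  induction u generalizing p with
  | nil => simp
  | cons l u ih =>
    obtain ⟨j, b⟩ := l
    rw [List.length_cons] at hp
    cases b
    · simp only [wordValue_cons, cond_false, mul_val, inv_val, inv_shift, stairs_shift,
        sub_neg_eq_add]
      rw [stairs_val_add_one _ _ _ (by omega), ih _ (by omega)]
    · simp only [wordValue_cons, cond_true, mul_val, stairs_shift]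
      rw [stairs_val_add_one _ _ _ (by omega), add_sub_right_comm, ih _ (by omega)]

/-- The values are constant from the length on. The position one further is positive even for the
empty word, so it lies in the window. -/
lemma isWindow_stairs (x : ℕ → A) : IsWindow (stairs x) fun u => u.length + 1 := by
  intro u h p hp
  push_cast at h hp
  induction p, hp.le using Int.leInduction with
  | base => exact absurd hp (lt_irrefl _)
  | succ p hle ih =>
    rw [wordValue_stairs_val_add_one x u p (by omega)]
    rcases hle.eq_or_lt with heq | hlt
    · exact h p (by omega) heq.ge
    · exact ih hlt

/-- The commutator is f_i divided by its translate by 1, which leaves the jump of f_i at 0. -/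
lemma single_eq_commutator_stairs (x : ℕ → A) (i : ℕ) :
    single (x i) = ⁅stairs x (i + 1), stairs x 0⁆ := by
  refine ext_val (by simp [commutatorElement_def]) fun p => ?_
  simp only [commutatorElement_def, mul_val, inv_val, stairs_shift, stairs_val_zero, mul_shift,
    inv_shift, single_val, stairs_val_succ]
  rcases lt_trichotomy p 0 with h | rfl | h
  · simp [h.ne, show ¬0 ≤ p by omega, show ¬0 ≤ p - 2 + 1 by omega]
  · simp
  · simp [h.ne', show 0 ≤ p by omega, show 0 ≤ p - 2 + 1 by omega]

/-- The translation factor gives infinite order even where `x i` is trivial. -/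
lemma stairs_zpow_eq_one (x : ℕ → A) (j : ℕ) (n : ℤ) (h : stairs x j ^ n = 1) : n = 0 := by
  have := congrArg shiftHom h
  rw [map_zpow, map_one] at this
  simpa [shiftHom, ← ofAdd_zsmul] using this

end Stairs

/-! ### The second level: two elements that generate a group containing the commutators. -/

section Sparse

/-- The words that define the function with values `b i` at `2 ^ i`. -/
def powWord (n : ℕ) : List (ℕ × Bool) :=
  if 2 ^ Nat.findGreatest (fun i => 2 ^ i = n) n = n then
    [(Nat.findGreatest (fun i => 2 ^ i = n) n, true)] else []

lemma powWord_two_pow (i : ℕ) : powWord (2 ^ i) = [(i, true)] := by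
  have h : 2 ^ Nat.findGreatest (fun k => 2 ^ k = 2 ^ i) (2 ^ i) = 2 ^ i :=
    Nat.findGreatest_spec (P := fun k => 2 ^ k = 2 ^ i) Nat.lt_two_pow_self.le rfl
  rw [powWord, if_pos h, Nat.pow_right_injective le_rfl h]

/-- `Nat.findGreatest` returns 0 if no exponent fits; the test in `powWord` rejects this default. -/
lemma powWord_of_ne {n : ℕ} (h : ∀ i, n ≠ 2 ^ i) : powWord n = [] :=
  if_neg fun h' => h _ h'.symm

lemma primrec_two_pow : Primrec fun n : ℕ => 2 ^ n :=
  (Primrec₂.unpaired'.1 Nat.Primrec.pow).comp (.const 2) .id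

lemma primrec_powWord : Primrec powWord := by
  have hf : Primrec fun n => Nat.findGreatest (fun i => 2 ^ i = n) n :=
    Primrec.nat_findGreatest (p := fun n i => 2 ^ i = n) .id
      (Primrec.eq.comp (primrec_two_pow.comp .snd) .fst)
  exact Primrec.ite (Primrec.eq.comp (primrec_two_pow.comp hf) .id)
    (Primrec.list_cons.comp (hf.pair (.const true)) (.const [])) (.const [])

/-- The words that define `sparse`. -/
def sparseWord (j : Fin 2) (p : ℕ) : List (ℕ × Bool) := if j = 0 then powWord p else []

/-- The function with values `b i` at `2 ^ i`, and the translation. -/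
def sparse (b : ℕ → A) (j : Fin 2) : ShiftWreath A := ofWords b (sparseWord j) (j.val : ℕ)

lemma isGivenBy_sparse (b : ℕ → A) : IsGivenBy (sparse b) b sparseWord Fin.val := by
  refine isGivenBy_ofWords b ?_ Primrec.fin_val fun j => by omega
  exact Primrec.ite (Primrec.eq.comp .fst (.const 0)) (primrec_powWord.comp .snd) (.const [])

@[simp] lemma sparse_shift_zero (b : ℕ → A) : (sparse b 0).shift = 0 := rfl
@[simp] lemma sparse_shift_one (b : ℕ → A) : (sparse b 1).shift = 1 := rfl
@[simp] lemma sparse_val_one (b : ℕ → A) (p : ℤ) : (sparse b 1).val p = 1 := by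
  simp [sparse, ofWords_val, sparseWord]

lemma sparse_val_two_pow (b : ℕ → A) (i : ℕ) : (sparse b 0).val (2 ^ i) = b i := by
  have h : ((2 : ℤ) ^ i).toNat = 2 ^ i := by exact_mod_cast Int.toNat_natCast (2 ^ i)
  simp [sparse, ofWords_val, sparseWord, h, powWord_two_pow]

lemma sparse_val_of_ne (b : ℕ → A) {p : ℤ} (hp : ∀ i : ℕ, p ≠ 2 ^ i) :
    (sparse b 0).val p = 1 := by
  rw [sparse, ofWords_val]
  split_ifs with h0
  · rw [sparseWord, if_pos rfl, powWord_of_ne fun i hi => hp i ?_, wordValue_nil]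
    rw [← Int.toNat_of_nonneg h0, hi]
    push_cast
    rfl
  · rfl

/-- Every other power of 2 is at distance at least half of `2 ^ i` from `2 ^ i`. -/
lemma two_pow_add_ne {i : ℕ} {a : ℤ} (h : 2 * |a| < 2 ^ i) (ha : a ≠ 0) (j : ℕ) :
    (2 : ℤ) ^ i + a ≠ 2 ^ j := by
  intro hj
  rcases lt_trichotomy i j with hlt | rfl | hlt
  · have : (2 : ℤ) ^ (i + 1) ≤ 2 ^ j := pow_le_pow_right₀ (by norm_num) hlt
    rw [pow_succ] at this
    have := le_abs_self a
    have := abs_nonneg a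
    omega
  · omega
  · have : (2 : ℤ) ^ (j + 1) ≤ 2 ^ i := pow_le_pow_right₀ (by norm_num) hlt
    rw [pow_succ] at this
    have := neg_abs_le a
    omega

lemma abs_add_one_bounds (a : ℤ) :
    (|a| ≤ |a + 1| + 1 ∧ |a + 1| ≤ |a| + 1) ∧ |a| ≤ |a - 1| + 1 ∧ |a - 1| ≤ |a| + 1 := by
  refine ⟨⟨?_, ?_⟩, ?_, ?_⟩ <;> cases abs_cases a <;> cases abs_cases (a + 1) <;>
    cases abs_cases (a - 1) <;> omega

/-- The exponent of `b i` in the value of a word over `sparse b` at `2 ^ i + a`, for `i` large. -/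
def expSum : List (Fin 2 × Bool) → ℤ → ℤ
  | [], _ => 0
  | (j, ε) :: u, a =>
    if j = 0 then (if a = 0 then bif ε then 1 else -1 else 0) + expSum u a
    else expSum u (bif ε then a - 1 else a + 1)

lemma expSum_eq_zero (u : List (Fin 2 × Bool)) (a : ℤ) (ha : (u.length : ℤ) < |a|) :
    expSum u a = 0 := by
  induction u generalizing a with
  | nil => rfl
  | cons l u ih =>
    obtain ⟨j, ε⟩ := l
    have hbd := abs_add_one_bounds a
    rw [List.length_cons] at ha
    rw [expSum]
    split_ifs with hj h0
    · subst h0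
      rw [abs_zero] at ha
      omega
    · rw [ih _ (by omega), zero_add]
    · cases ε
      · exact ih _ (by simp only [cond_false]; omega)
      · exact ih _ (by simp only [cond_true]; omega)

/-- While the word is read, the offset from `2 ^ i` stays at most `|a| + u.length`, hence below half
of `2 ^ i`; only `b i` is met there. The exponent does not involve `i`. -/
lemma wordValue_sparse_val_near (b : ℕ → A) (u : List (Fin 2 × Bool)) (i : ℕ) (a : ℤ)
    (ha : 2 * |a| + 2 * u.length < 2 ^ i) :
    (wordValue (sparse b) u).val (2 ^ i + a) = b i ^ expSum u a := by
  induction u generalizing a with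
  | nil => simp [expSum]
  | cons l u ih =>
    obtain ⟨j, ε⟩ := l
    have hbd := abs_add_one_bounds a
    rw [List.length_cons] at ha
    have hF : (sparse b 0).val (2 ^ i + a) = b i ^ (if a = 0 then 1 else 0 : ℤ) := by
      split_ifs with h0
      · rw [h0, add_zero, sparse_val_two_pow, zpow_one]
      · rw [sparse_val_of_ne b (two_pow_add_ne (by omega) h0), zpow_zero]
    rcases Fin.exists_fin_two.1 ⟨j, rfl⟩ with rfl | rfl
    · cases ε
      · simp only [wordValue_cons, cond_false, mul_val, inv_val, inv_shift, sparse_shift_zero,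
          neg_zero, add_zero, sub_zero, expSum, hF]
        rw [ih _ (by omega), if_true, zpow_add, ← zpow_neg]
        split_ifs <;> simp
      · simp only [wordValue_cons, cond_true, mul_val, sparse_shift_zero, sub_zero, expSum, hF]
        rw [ih _ (by omega), if_true, zpow_add]
    · cases ε
      · simp only [wordValue_cons, cond_false, mul_val, inv_val, inv_shift, sparse_shift_one,
          sparse_val_one, inv_one, one_mul, sub_neg_eq_add, expSum, add_assoc]
        rw [ih _ (by omega), if_neg (by decide)]
      · simp only [wordValue_cons, cond_true, mul_val, sparse_shift_one,
          sparse_val_one, one_mul, expSum, add_sub_assoc]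
        rw [ih _ (by omega), if_neg (by decide)]

lemma wordValue_sparse_val_far (b : ℕ → A) (u : List (Fin 2 × Bool)) (p : ℤ)
    (hp : ∀ i : ℕ, (u.length : ℤ) < |p - 2 ^ i|) : (wordValue (sparse b) u).val p = 1 := by
  induction u generalizing p with
  | nil => simp
  | cons l u ih =>
    obtain ⟨j, ε⟩ := l
    simp only [List.length_cons] at hp
    have hF : (sparse b 0).val p = 1 := sparse_val_of_ne b fun i hi => by
      have := hp i
      rw [hi, sub_self, abs_zero] at this
      omega
    rcases Fin.exists_fin_two.1 ⟨j, rfl⟩ with rfl | rfl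
    · have := ih p fun i => by have := hp i; omega
      cases ε <;> simp [hF, this]
    · cases ε
      · simpa using ih (p + 1) fun i => by
          have := hp i
          have := abs_add_one_bounds (p - 2 ^ i)
          rw [add_sub_right_comm]
          omega
      · simpa using ih (p - 1) fun i => by
          have := hp i
          have := abs_add_one_bounds (p - 2 ^ i)
          rw [sub_right_comm]
          omega

lemma isWindow_sparse {b : ℕ → A} (hb : ∀ i (n : ℤ), b i ^ n = 1 → n = 0) :
    IsWindow (sparse b) fun u => 2 ^ (u.length + 3) := by
  intro u h p hp
  have hlen : (u.length : ℤ) < 2 ^ u.length := by exact_mod_cast Nat.lt_two_pow_self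
  push_cast at h hp
  rw [pow_add] at hp
  have hE : ∀ a, expSum u a = 0 := by
    intro a
    rcases lt_or_ge (u.length : ℤ) |a| with ha | ha
    · exact expSum_eq_zero u a ha
    -- `2 ^ (u.length + 2)` exceeds `4 * u.length`, so the formula near it covers all offsets up to
    -- the length, and these positions lie in the window.
    · refine hb (u.length + 2) _ ?_
      have h1 := neg_abs_le a
      have h2 := le_abs_self a
      rw [← wordValue_sparse_val_near b u _ a (by rw [pow_add]; omega)]
      exact h _ (by rw [pow_add]; omega) (by rw [pow_add, pow_add]; omega)
  by_cases hfar : ∀ i : ℕ, (u.length : ℤ) < |p - 2 ^ i|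
  · exact wordValue_sparse_val_far b u p hfar
  · push Not at hfar
    obtain ⟨i, hi⟩ := hfar
    have h2 := le_abs_self (p - 2 ^ i)
    have := wordValue_sparse_val_near b u i (p - 2 ^ i) (by omega)
    rwa [add_sub_cancel, hE, zpow_zero] at this

/-- The translations. -/
def translation : Multiplicative ℤ →* ShiftWreath A where
  toFun m := ⟨1, m.toAdd, 0, fun _ _ => rfl⟩
  map_one' := rfl
  map_mul' _ _ := ext_val rfl fun _ => (one_mul (1 : A)).symm

lemma sparse_one_zpow (b : ℕ → A) (k : ℤ) :
    sparse b 1 ^ k = translation (Multiplicative.ofAdd k) := by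
  have : sparse b 1 = translation (Multiplicative.ofAdd 1) :=
    ext_val rfl fun p => sparse_val_one b p
  rw [this, ← map_zpow, ← ofAdd_zsmul, smul_eq_mul, mul_one]

/-- The conjugate of the sparse function that is supported on the `2 ^ i - k`. -/
def sparseConj (b : ℕ → A) (k : ℤ) : ShiftWreath A :=
  sparse b 1 ^ (-k) * sparse b 0 * sparse b 1 ^ k

lemma sparseConj_shift (b : ℕ → A) (k : ℤ) : (sparseConj b k).shift = 0 := by
  simp [sparseConj, sparse_one_zpow, translation]

lemma sparseConj_val (b : ℕ → A) (k p : ℤ) :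
    (sparseConj b k).val p = (sparse b 0).val (p + k) := by
  simp [sparseConj, sparse_one_zpow, translation]

/-- A nonzero point 2^j - 1 of the second support is positive and odd, whereas a point 2^k - 2^(i+1)
of the first is even, or negative when k = 0. So the supports share only 0. -/
lemma single_commutator_eq (b : ℕ → A) (i : ℕ) :
    single ⁅b (i + 1), b 0⁆ = ⁅sparseConj b (2 ^ (i + 1)), sparseConj b 1⁆ := by
  refine ext_val (by simp [commutatorElement_def, sparseConj_shift]) fun p => ?_
  have hv : (⁅sparseConj b (2 ^ (i + 1)), sparseConj b 1⁆ : ShiftWreath A).val p =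
      ⁅(sparse b 0).val (p + 2 ^ (i + 1)), (sparse b 0).val (p + 1)⁆ := by
    simp [commutatorElement_def, sparseConj_shift, sparseConj_val]
  rw [hv, single_val]
  split_ifs with hp
  · have h1 := sparse_val_two_pow b 0
    rw [pow_zero] at h1
    rw [hp, zero_add, zero_add, sparse_val_two_pow, h1]
  by_cases h1 : ∃ j : ℕ, p + 1 = 2 ^ j
  · obtain ⟨j, hj⟩ := h1
    rw [sparse_val_of_ne b (p := p + 2 ^ (i + 1)) fun k hk => ?_, commutatorElement_one_left]
    cases j with
    | zero => rw [pow_zero] at hj; omega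
    | succ j =>
      rw [pow_succ] at hj
      cases k with
      | zero =>
        rw [pow_zero] at hk
        have : (0 : ℤ) < 2 ^ j := by positivity
        have : (0 : ℤ) < 2 ^ (i + 1) := by positivity
        omega
      | succ k =>
        rw [pow_succ, pow_succ] at hk
        omega
  · rw [sparse_val_of_ne b fun j hj => h1 ⟨j, hj⟩, commutatorElement_one_right]

lemma single_commutator_mem_closure (b : ℕ → A) (i : ℕ) :
    single ⁅b (i + 1), b 0⁆ ∈ Subgroup.closure (Set.range (sparse b)) := by
  have hmem : ∀ k, sparseConj b k ∈ Subgroup.closure (Set.range (sparse b)) := fun k => by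
    have h0 := Subgroup.subset_closure (Set.mem_range_self (f := sparse b) 0)
    have h1 := Subgroup.subset_closure (Set.mem_range_self (f := sparse b) 1)
    exact mul_mem (mul_mem (zpow_mem h1 _) h0) (zpow_mem h1 _)
  rw [single_commutator_eq, commutatorElement_def]
  exact mul_mem (mul_mem (mul_mem (hmem _) (hmem _)) (inv_mem (hmem _))) (inv_mem (hmem _))

end Sparse

end ShiftWreath

/-! ### Pulling orders back to a subgroup. -/

lemma IsLeftOrder.comap {G K : Type*} [Group G] [Group K] {r : K → K → Prop} (hr : IsLeftOrder r)
    {f : G →* K} (hf : Function.Injective f) : IsLeftOrder fun a b => r (f a) (f b) where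
  isLinearOrder :=
    { refl := fun _ => hr.isLinearOrder.refl _
      trans := fun _ _ _ h h' => hr.isLinearOrder.trans _ _ _ h h'
      antisymm := fun _ _ h h' => hf (hr.isLinearOrder.antisymm _ _ h h')
      total := fun _ _ => hr.isLinearOrder.total _ _ }
  mul_left c a b h := by simpa using hr.mul_left (f c) _ _ h

lemma IsBiOrder.comap {G K : Type*} [Group G] [Group K] {r : K → K → Prop} (hr : IsBiOrder r)
    {f : G →* K} (hf : Function.Injective f) : IsBiOrder fun a b => r (f a) (f b) where
  toIsLeftOrder := hr.toIsLeftOrder.comap hf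
  mul_right c a b h := by simpa using hr.mul_right (f c) _ _ h

/-- A subgroup with decidable membership has a generating sequence with respect to which the
restriction of a computable relation is computable. -/
theorem exists_isComputableOrder_comap {H G ι : Type*} [Group H] [Group G] [Primcodable ι]
    {s : ι → G} {q : G → G → Prop} {φ : H →* G} (hs : GeneratesGroup s)
    (hq : IsComputableOrder s q) (hm : HasDecidableMembership s φ.range)
    (hφ : Function.Injective φ) :
    ∃ x : ℕ → H, GeneratesGroup x ∧ IsComputableOrder x fun a b => q (φ a) (φ b) := by
  obtain ⟨m, hm, hmr⟩ := ComputablePred.computable_iff.1 hm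
  have hmr : ∀ v, wordValue s v ∈ φ.range ↔ m v = true := fun v => iff_of_eq (congrFun hmr v)
  let d : ℕ → List (ι × Bool) := fun k => (Encodable.decode k).getD []
  have hd : Computable d := Computable.option_getD Computable.decode (.const [])
  -- Words with value outside the image are replaced by the empty word; every element of the image
  -- still has a word in the list.
  let v : ℕ → List (ι × Bool) := fun k => bif m (d k) then d k else []
  have hv : Computable v := .cond (hm.comp hd) hd (.const [])
  have hvr : ∀ k, wordValue s (v k) ∈ φ.range := by
    intro k
    cases hk : m (d k)
    · simp [v, hk, one_mem]
    · simpa [v, hk] using (hmr _).2 hk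
  choose x hx using hvr
  have hx' : ∀ h, ∃ k, x k = h := by
    intro h
    obtain ⟨w, hw⟩ := exists_wordValue_eq s hs (φ h)
    have hmw : m w = true := (hmr w).1 ⟨h, hw.symm⟩
    refine ⟨Encodable.encode w, hφ ?_⟩
    rw [hx]
    simpa [v, d, hmw] using hw
  refine ⟨x, ?_, ?_⟩
  · rw [GeneratesGroup, Set.range_eq_univ.2 hx', Subgroup.closure_univ]
  · let f : ℕ × Bool → List (ι × Bool) := fun l => bif l.2 then v l.1 else invWord (v l.1)
    have hf : Computable f := .cond .snd (hv.comp .fst) (primrec_invWord.to_comp.comp (hv.comp .fst))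
    have hval : ∀ u, wordValue s (u.flatMap f) = φ (wordValue x u) := by
      intro u
      induction u with
      | nil => simp
      | cons l u ih =>
        rw [List.flatMap_cons, wordValue_append, ih, wordValue_cons, map_mul]
        obtain ⟨k, _ | _⟩ := l <;> simp [f, hx]
    obtain ⟨c, hc, hcq⟩ := ComputablePred.computable_iff.1 hq
    have hf' := computable_flatMap hf
    refine ComputablePred.computable_iff.2 ⟨_, hc.comp ((hf'.comp .fst).pair (hf'.comp .snd)),
      funext fun p => ?_⟩
    beta_reduce
    rw [← hval, ← hval]
    exact congrFun hcq (p.1.flatMap f, p.2.flatMap f)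

/-! ### The embedding and the equivalences. -/

open ShiftWreath in
/-- A group with a left-order that is computable with respect to a generating sequence embeds as a
subnormal subgroup with decidable membership in a finitely generated group with a computable
left-order that continues the given one, and is a bi-order if the given one is. -/
theorem exists_subnormal_embedding {H : Type u} [Group H] {x : ℕ → H} {r : H → H → Prop}
    (hx : GeneratesGroup x) (hr : IsLeftOrder r) (hc : IsComputableOrder x r) :
    ∃ (G : Type u) (_ : Group G) (n : ℕ) (s : Fin n → G) (q : G → G → Prop) (φ : H →* G),
      GeneratesGroup s ∧ IsLeftOrder q ∧ (IsBiOrder r → IsBiOrder q) ∧ IsComputableOrder s q ∧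
        Function.Injective φ ∧ HasDecidableMembership s φ.range ∧ φ.range.IsSubnormal ∧
          ∀ a b, r a b ↔ q (φ a) (φ b) := by
  let y := sparse (stairs x)
  let G := Subgroup.closure (Set.range y)
  let s : Fin 2 → G := fun j => ⟨y j, Subgroup.subset_closure ⟨j, rfl⟩⟩
  have hsy : ∀ u, ((wordValue s u : G) : ShiftWreath (ShiftWreath H)) = wordValue y u :=
    map_wordValue s G.subtype
  let ψ : H →* ShiftWreath (ShiftWreath H) := single.comp single
  have hψG : ∀ h, ψ h ∈ G := by
    have hle : Subgroup.closure (Set.range x) ≤ G.comap ψ := by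
      rw [Subgroup.closure_le]
      rintro _ ⟨i, rfl⟩
      change single (single (x i)) ∈ G
      rw [single_eq_commutator_stairs]
      exact single_commutator_mem_closure _ i
    rw [show Subgroup.closure (Set.range x) = ⊤ from hx] at hle
    exact fun h => hle (Subgroup.mem_top h)
  let φ : H →* G := ψ.codRestrict G hψG
  -- Membership and subnormality are established in the full iterated wreath product and pulled back
  -- to `G`.
  have hrange : φ.range = (((⊤ : Subgroup H).map single).map single).comap G.subtype := by
    ext g
    constructor
    · rintro ⟨h, rfl⟩
      exact ⟨_, ⟨h, Subgroup.mem_top h, rfl⟩, rfl⟩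
    · rintro ⟨_, ⟨h, -, rfl⟩, hg⟩
      exact ⟨h, Subtype.ext hg⟩
  have hwin : Primrec fun u : List (ℕ × Bool) => u.length + 1 :=
    Primrec.succ.comp Primrec.list_length
  have hwin' : Primrec fun u : List (Fin 2 × Bool) => 2 ^ (u.length + 3) :=
    primrec_two_pow.comp (Primrec.nat_add.comp Primrec.list_length (.const 3))
  have hr1 := isLeftOrder_lexLE hr
  -- The elements `stairs x` need not generate `ShiftWreath H`: the second level evaluates to words
  -- in them only.
  have hc1 := (isGivenBy_stairs x).isComputableOrder_lexLE (isWindow_stairs x) hwin hr hc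
  have hy := isGivenBy_sparse (stairs x)
  have hyN := isWindow_sparse (stairs_zpow_eq_one x)
  have hc2 := hy.isComputableOrder_lexLE hyN hwin' hr1 hc1
  have htop : HasDecidableMembership x (⊤ : Subgroup H) :=
    ComputablePred.computable_iff.2 ⟨fun _ => true, .const true, funext fun u => by simp⟩
  have hm1 := (isGivenBy_stairs x).hasDecidableMembership_map_single (isWindow_stairs x) hwin hr hc
    htop
  have hm2 := hy.hasDecidableMembership_map_single hyN hwin' hr1 hc1 hm1
  refine ⟨G, inferInstance, 2, s, fun a b => lexLE (lexLE r) a b, φ, ?_,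
    (isLeftOrder_lexLE hr1).comap G.subtype_injective,
    fun hb => (isBiOrder_lexLE (isBiOrder_lexLE hb)).comap G.subtype_injective, ?_,
    fun a b h => single_injective (single_injective (congrArg Subtype.val h)), ?_, ?_,
    fun a b => ?_⟩
  · have : Set.range s = Subtype.val ⁻¹' Set.range y := by
      ext g
      exact exists_congr fun j => Subtype.ext_iff
    rw [GeneratesGroup, this]
    exact Subgroup.closure_closure_coe_preimage
  · exact hc2.of_eq fun p => by
      beta_reduce
      rw [hsy, hsy]
  · rw [hrange]
    exact hm2.of_eq fun u => by rw [Subgroup.mem_comap, Subgroup.coe_subtype, hsy]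
  · rw [hrange]
    exact (isSubnormal_map_single (isSubnormal_map_single .top)).comap _
  · exact ((lexLE_single hr1.isLinearOrder.refl _ _).trans
      (lexLE_single hr.isLinearOrder.refl a b)).symm

theorem corollary4 {H : Type u} [Group H] [Countable H] :
    -- left-orders: subgroups
    ((∃ (x : ℕ → H) (r : H → H → Prop), IsComputableLeftOrder x r) ↔
      ∃ (G : Type u) (_ : Group G) (n : ℕ) (s : Fin n → G) (q : G → G → Prop) (φ : H →* G),
        IsComputableLeftOrder s q ∧ Function.Injective φ ∧
          HasDecidableMembership s φ.range) ∧
    -- left-orders: subnormal subgroups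
    ((∃ (x : ℕ → H) (r : H → H → Prop), IsComputableLeftOrder x r) ↔
      ∃ (G : Type u) (_ : Group G) (n : ℕ) (s : Fin n → G) (q : G → G → Prop) (φ : H →* G),
        IsComputableLeftOrder s q ∧ Function.Injective φ ∧
          HasDecidableMembership s φ.range ∧ φ.range.IsSubnormal) ∧
    -- left-orders: a fixed computable order is continued
    (∀ (x : ℕ → H) (r : H → H → Prop), IsComputableLeftOrder x r →
      ∃ (G : Type u) (_ : Group G) (n : ℕ) (s : Fin n → G) (q : G → G → Prop) (φ : H →* G),
        IsComputableLeftOrder s q ∧ Function.Injective φ ∧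
          HasDecidableMembership s φ.range ∧ φ.range.IsSubnormal ∧
          ∀ a b, r a b ↔ q (φ a) (φ b)) ∧
    -- bi-orders: subgroups
    ((∃ (x : ℕ → H) (r : H → H → Prop), IsComputableBiOrder x r) ↔
      ∃ (G : Type u) (_ : Group G) (n : ℕ) (s : Fin n → G) (q : G → G → Prop) (φ : H →* G),
        IsComputableBiOrder s q ∧ Function.Injective φ ∧
          HasDecidableMembership s φ.range) ∧
    -- bi-orders: subnormal subgroups
    ((∃ (x : ℕ → H) (r : H → H → Prop), IsComputableBiOrder x r) ↔
      ∃ (G : Type u) (_ : Group G) (n : ℕ) (s : Fin n → G) (q : G → G → Prop) (φ : H →* G),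
        IsComputableBiOrder s q ∧ Function.Injective φ ∧
          HasDecidableMembership s φ.range ∧ φ.range.IsSubnormal) ∧
    -- bi-orders: a fixed computable order is continued
    (∀ (x : ℕ → H) (r : H → H → Prop), IsComputableBiOrder x r →
      ∃ (G : Type u) (_ : Group G) (n : ℕ) (s : Fin n → G) (q : G → G → Prop) (φ : H →* G),
        IsComputableBiOrder s q ∧ Function.Injective φ ∧
          HasDecidableMembership s φ.range ∧ φ.range.IsSubnormal ∧
          ∀ a b, r a b ↔ q (φ a) (φ b)) := by
  have left : ∀ (x : ℕ → H) (r : H → H → Prop), IsComputableLeftOrder x r →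
      ∃ (G : Type u) (_ : Group G) (n : ℕ) (s : Fin n → G) (q : G → G → Prop) (φ : H →* G),
        IsComputableLeftOrder s q ∧ Function.Injective φ ∧
          HasDecidableMembership s φ.range ∧ φ.range.IsSubnormal ∧
          ∀ a b, r a b ↔ q (φ a) (φ b) := by
    rintro x r ⟨hx, hr, hc⟩
    obtain ⟨G, _, n, s, q, φ, hs, hq, -, hqc, h⟩ := exists_subnormal_embedding hx hr hc
    exact ⟨G, _, n, s, q, φ, ⟨hs, hq, hqc⟩, h⟩
  have bi : ∀ (x : ℕ → H) (r : H → H → Prop), IsComputableBiOrder x r →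
      ∃ (G : Type u) (_ : Group G) (n : ℕ) (s : Fin n → G) (q : G → G → Prop) (φ : H →* G),
        IsComputableBiOrder s q ∧ Function.Injective φ ∧
          HasDecidableMembership s φ.range ∧ φ.range.IsSubnormal ∧
          ∀ a b, r a b ↔ q (φ a) (φ b) := by
    rintro x r ⟨hx, hr, hc⟩
    obtain ⟨G, _, n, s, q, φ, hs, -, hq, hqc, h⟩ :=
      exists_subnormal_embedding hx hr.toIsLeftOrder hc
    exact ⟨G, _, n, s, q, φ, ⟨hs, hq hr, hqc⟩, h⟩
  have left_comap : ∀ {G : Type u} [Group G] {n : ℕ} {s : Fin n → G} {q : G → G → Prop}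
      {φ : H →* G}, IsComputableLeftOrder s q → Function.Injective φ →
      HasDecidableMembership s φ.range →
      ∃ (x : ℕ → H) (r : H → H → Prop), IsComputableLeftOrder x r := by
    intro G _ n s q φ h hφ hm
    obtain ⟨x, hx, hc⟩ := exists_isComputableOrder_comap h.generates h.computable hm hφ
    exact ⟨x, _, hx, h.isLeftOrder.comap hφ, hc⟩
  have bi_comap : ∀ {G : Type u} [Group G] {n : ℕ} {s : Fin n → G} {q : G → G → Prop}
      {φ : H →* G}, IsComputableBiOrder s q → Function.Injective φ →
      HasDecidableMembership s φ.range →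
      ∃ (x : ℕ → H) (r : H → H → Prop), IsComputableBiOrder x r := by
    intro G _ n s q φ h hφ hm
    obtain ⟨x, hx, hc⟩ := exists_isComputableOrder_comap h.generates h.computable hm hφ
    exact ⟨x, _, hx, h.isBiOrder.comap hφ, hc⟩
  refine ⟨⟨?_, ?_⟩, ⟨?_, ?_⟩, left, ⟨?_, ?_⟩, ⟨?_, ?_⟩, bi⟩
  · rintro ⟨x, r, h⟩
    obtain ⟨G, _, n, s, q, φ, hq, hφ, hm, -, -⟩ := left x r h
    exact ⟨G, _, n, s, q, φ, hq, hφ, hm⟩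
  · rintro ⟨G, _, n, s, q, φ, hq, hφ, hm⟩
    exact left_comap hq hφ hm
  · rintro ⟨x, r, h⟩
    obtain ⟨G, _, n, s, q, φ, hq, hφ, hm, hn, -⟩ := left x r h
    exact ⟨G, _, n, s, q, φ, hq, hφ, hm, hn⟩
  · rintro ⟨G, _, n, s, q, φ, hq, hφ, hm, -⟩
    exact left_comap hq hφ hm
  · rintro ⟨x, r, h⟩
    obtain ⟨G, _, n, s, q, φ, hq, hφ, hm, -, -⟩ := bi x r h
    exact ⟨G, _, n, s, q, φ, hq, hφ, hm⟩
  · rintro ⟨G, _, n, s, q, φ, hq, hφ, hm⟩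
    exact bi_comap hq hφ hm
  · rintro ⟨x, r, h⟩
    obtain ⟨G, _, n, s, q, φ, hq, hφ, hm, hn, -⟩ := bi x r h
    exact ⟨G, _, n, s, q, φ, hq, hφ, hm, hn⟩
  · rintro ⟨G, _, n, s, q, φ, hq, hφ, hm, -⟩
    exact bi_comap hq hφ hm
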